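/- All vector fields are $C^\infty$, and $I=[0,1]$. Let $F$ be a vector field on an open set $U\subset\mathbb R^N$ (regarded as the ambient manifold), with singular set $\Sigma_F=\{x\in U: F(x)=0\}$ and local flow $\mathbf F(x,t)$ on $U$. For an open set $V\subset U$ let $\mathcal E(F,V)$ be the set of $C^\infty$ maps $h:V\to U$ such that $h(o\cap V)\subset o$ for every orbit $o$ of $F$ and $h$ is a local diffeomorphism at every point of $\Sigma_F\cap V$. For $S=\mathbb R^l$ or $S=\mathbb R^l_+=\{\sigma\in\mathbb R^l:\sigma_l\ge 0\}$ (a point if $l=0$), $d\ge 0$ and $0\le k\le\infty$, an $(S;I^d,k)$-deformation in $\mathcal E(F,V)$ is a continuous map $\Omega:V\times S\times I^d\to U$ such that * $\Omega_{(\sigma,\tau)}=\Omega(\cdot,\sigma,\tau)\in\mathcal E(F,V)$ for all $(\sigma,\tau)\in S\times I^d$; * for every $\tau\in I^d$ the map $\Omega_\tau=\Omega(\cdot,\cdot,\tau):V\times S\to U$ is $C^\infty$, and the jet map $(x,\sigma,\tau)\mapsto j^k\Omega_\tau(x,\sigma)$ is continuous (for $k=\infty$: the $r$-jet map is continuous for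 every finite $r$). The vector field $F$ has property $ES(l,d,k)$ at $z\in U$ if $z\in\Sigma_F$, $\Sigma_F$ is nowhere dense in some neighbourhood of $z$, and the following holds. Let * $V\subset U$ be a connected open neighbourhood of $z$, and let $S$ be $\mathbb R^l$ or $\mathbb R^l_+$; * $\Omega$ be an $(S;I^d,k)$-deformation in $\mathcal E(F,V)$, $(\sigma_0,\tau_0)\in S\times I^d$, and $\alpha:V\to\mathbb R$ a $C^\infty$ function with $\Omega(x,\sigma_0,\tau_0)=\mathbf F(x,\alpha(x))$ for all $x\in V$; * $\Lambda:(V\setminus\Sigma_F)\times S\times I^d\to\mathbb R$ be a continuous function with $\Omega(x,\sigma,\tau)=\mathbf F(x,\Lambda(x,\sigma,\tau))$ for all $(x,\sigma,\tau)$ in its domain and with $\Lambda(\cdot,\sigma_0,\tau_0)=\alpha$ on $V\setminus\Sigma_F$ (such a $\Lambda$ is unique if it exists). Then there is an open neighbourhood $W$ of $(z,\sigma_0)$ in $V\times S$ such that for each $\tau\in I^d$ the function $\Lambda(\cdot,\cdot,\tau)$ extends from $W\cap((V\setminus\Sigma_F)\times S)$ to a $C^\infty$ function on $W$. **Lemma.**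 Let $m,n,l,d\ge 0$ be integers and $0\le k\le\infty$. Let $G$ be a vector field on an open neighbourhood of $0$ in $\mathbb R^m$ and $F$ a vector field on an open neighbourhood of $0$ in $\mathbb R^{m+n}=\mathbb R^m\times\mathbb R^n$. Suppose that the germ of $F$ at $0$ is a regular extension of the germ of $G$ at $0$, that is, $F(x,y)=(G(x),H(x,y))$ near $0$ for some $C^\infty$ map $H$ into $\mathbb R^n$, and suppose that $F(0)=0$ (hence $G(0)=0$). If $G$ has property $ES(l+n,d,k)$ at $0\in\mathbb R^m$, then $F$ has property $ES(l,d,k)$ at $0\in\mathbb R^{m+n}$. -/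

import Mathlib

open scoped ContDiff Topology Manifold

/-! Vector fields live on an open subset `U` of a finite-dimensional real vector space `E`,
considered as a manifold; they are functions `E → E` whose values outside `U` play no role. -/

/-- The set of singular points of the vector field `F` on `U`. -/
def singularSet {E : Type*} [NormedAddCommGroup E] [NormedSpace ℝ E]
    (U : Set E) (F : E → E) : Set E :=
  {x | x ∈ U ∧ F x = 0}

/-- The graph of the local flow of the vector field `F` on the manifold `U`: the point `(x, t)`
lies in the domain of the local flow, and the flow moves `x` to `y` in time `t`. That is, some
integral curve of `F` lying in `U`, defined on an open interval that contains `0` and `t`, is at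
`x` at time `0` and at `y` at time `t`. -/
def FlowsTo {E : Type*} [NormedAddCommGroup E] [NormedSpace ℝ E]
    (U : Set E) (F : E → E) (x : E) (t : ℝ) (y : E) : Prop :=
  ∃ (γ : ℝ → E) (J : Set ℝ), IsOpen J ∧ J.OrdConnected ∧ 0 ∈ J ∧ t ∈ J ∧
    Set.MapsTo γ J U ∧ IsIntegralCurveOn γ (fun _ => F) J ∧ γ 0 = x ∧ γ t = y

/-- The orbit of `x` under the local flow of the vector field `F` on `U`. -/
def flowOrbit {E : Type*} [NormedAddCommGroup E] [NormedSpace ℝ E]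
    (U : Set E) (F : E → E) (x : E) : Set E :=
  {y | ∃ t : ℝ, FlowsTo U F x t y}

/-- The set `𝓔(F, V)` of smooth maps `h : V → U` that send the intersection of `V` with each orbit
of `F` into that orbit, and that are local diffeomorphisms at every singular point of `F`
in `V`. -/
def endoSet {E : Type*} [NormedAddCommGroup E] [NormedSpace ℝ E]
    (U : Set E) (F : E → E) (V : Set E) : Set (E → E) :=
  {h | ContDiffOn ℝ ∞ h V ∧ Set.MapsTo h V U ∧
    (∀ x ∈ V, h x ∈ flowOrbit U F x) ∧
    ∀ x ∈ singularSet U F ∩ V, IsLocalDiffeomorphAt 𝓘(ℝ, E) 𝓘(ℝ, E) ∞ h x}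

/-- `Ω : V × S × T → N` is an `(S; T, k)`-deformation in the set `A` of smooth maps on `V`.
Here `V ⊆ E` and `S ⊆ P`, where `V × S` is a set with unique differentials (such as an open set
times a half-space), and `N` is open in `E'`, so that the `k`-jet of `Ω_τ` at `(x, σ)` is given by
the iterated derivatives of `Ω_τ` of order at most `k`; for `k = ∞` all orders occur. -/
structure IsDeformation {E P E' T : Type*}
    [NormedAddCommGroup E] [NormedSpace ℝ E] [NormedAddCommGroup P] [NormedSpace ℝ P]
    [NormedAddCommGroup E'] [NormedSpace ℝ E'] [TopologicalSpace T]
    (V : Set E) (S : Set P) (k : ℕ∞) (A : Set (E → E')) (Ω : E → P → T → E') : Prop where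
  continuousOn : ContinuousOn (fun q : (E × P) × T => Ω q.1.1 q.1.2 q.2)
    ((V ×ˢ S) ×ˢ Set.univ)
  mem : ∀ σ ∈ S, ∀ τ : T, (fun x => Ω x σ τ) ∈ A
  smooth : ∀ τ : T, ContDiffOn ℝ ∞ (fun p : E × P => Ω p.1 p.2 τ) (V ×ˢ S)
  jet : ∀ i : ℕ, (i : ℕ∞) ≤ k →
    ContinuousOn (fun q : (E × P) × T =>
        iteratedFDerivWithin ℝ i (fun p : E × P => Ω p.1 p.2 q.2) (V ×ˢ S) q.1)
      ((V ×ˢ S) ×ˢ Set.univ)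

/-- The closed half-space of `ℝ^l` where the last coordinate is nonnegative
(for `l = 0` it is the point `ℝ^0`). -/
def halfSpace (l : ℕ) : Set (Fin l → ℝ) :=
  {σ | ∀ i : Fin l, (i : ℕ) + 1 = l → 0 ≤ σ i}

/-- The property `ES(l, d, k)` of the vector field `F` on `U` at the point `z`: the point `z` is
singular, the singular set is nowhere dense at `z`, and continuous shift functions of
`(S; I^d, k)`-deformations in `𝓔(F, V)` that prolong a smooth shift function on `V` of one member
`(σ₀, τ₀)` of the deformation extend smoothly, for each `τ`, to one and the same neighbourhood `W`
of `(z, σ₀)` in `V × S`. A continuous shift function with prescribed values at `(σ₀, τ₀)` is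
automatically unique. -/
def HasES {E : Type*} [NormedAddCommGroup E] [NormedSpace ℝ E]
    (U : Set E) (F : E → E) (z : E) (l d : ℕ) (k : ℕ∞) : Prop :=
  z ∈ singularSet U F ∧
  (∃ N ∈ 𝓝 z, IsNowhereDense (singularSet U F ∩ N)) ∧
  ∀ (V : Set E), IsOpen V → IsConnected V → z ∈ V → V ⊆ U →
  ∀ (S : Set (Fin l → ℝ)), (S = Set.univ ∨ S = halfSpace l) →
  ∀ (Ω : E → (Fin l → ℝ) → (Fin d → unitInterval) → E),
    IsDeformation V S k (endoSet U F V) Ω →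
  ∀ σ₀ ∈ S, ∀ (τ₀ : Fin d → unitInterval) (α : E → ℝ),
    ContDiffOn ℝ ∞ α V →
    (∀ x ∈ V, FlowsTo U F x (α x) (Ω x σ₀ τ₀)) →
  ∀ (L : E → (Fin l → ℝ) → (Fin d → unitInterval) → ℝ),
    ContinuousOn (fun q : (E × (Fin l → ℝ)) × (Fin d → unitInterval) => L q.1.1 q.1.2 q.2)
      (((V \ singularSet U F) ×ˢ S) ×ˢ Set.univ) →
    (∀ x ∈ V \ singularSet U F, ∀ σ ∈ S, ∀ τ, FlowsTo U F x (L x σ τ) (Ω x σ τ)) →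
    (∀ x ∈ V \ singularSet U F, L x σ₀ τ₀ = α x) →
  ∃ W : Set (E × (Fin l → ℝ)), IsOpen W ∧ (z, σ₀) ∈ W ∧
    ∀ τ : Fin d → unitInterval, ∃ Lext : E × (Fin l → ℝ) → ℝ,
      ContDiffOn ℝ ∞ Lext (W ∩ V ×ˢ S) ∧
      ∀ p ∈ W ∩ (V \ singularSet U F) ×ˢ S, Lext p = L p.1 p.2 τ

/-- The germ of `F` at the origin of `ℝ^(m+n) = ℝ^m × ℝ^n` is a regular extension of the germ of
`G` at the origin of `ℝ^m`: near the origin `F (x, y) = (G x, H (x, y))` with `H` smooth. -/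
def IsRegularExtension {m n : ℕ}
    (F : (Fin m → ℝ) × (Fin n → ℝ) → (Fin m → ℝ) × (Fin n → ℝ))
    (G : (Fin m → ℝ) → (Fin m → ℝ)) : Prop :=
  ∃ (H : (Fin m → ℝ) × (Fin n → ℝ) → (Fin n → ℝ)) (B : Set ((Fin m → ℝ) × (Fin n → ℝ))),
    IsOpen B ∧ 0 ∈ B ∧ ContDiffOn ℝ ∞ H B ∧ ∀ p ∈ B, F p = (G p.1, H p)

/-! ### Integral curves and the graph of the local flow -/

section FlowLemmas

variable {E : Type*} [NormedAddCommGroup E] [NormedSpace ℝ E]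

/-! The idea is to treat the vertical coordinate `y` as `n` additional deformation parameters. Since
`F` projects to `G`, a time-`t` trajectory of `F` projects to a time-`t` trajectory of `G`. Hence
the first component of `Ω ((x, y), σ, τ)`, read as a map of `x` with parameters `(y, σ)`, is a
deformation for `G` with the same shift function, and `ES(l + n, d, k)` for `G` gives smoothness
jointly in `x`, `y` and `σ`.

Four points need care. The product structure is only local, so the trajectories joining `p` to `Ω p
σ τ` must stay near the origin even though the shift times may be unbounded near the singular set;
`IsDeformation.exists_ball_flowsTo` obtains this from connectedness of the parameters. The slices
must be local diffeomorphisms at every zero of `G`, including those over which `F` does not vanish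
(`fst_comp_slice_mem_endoSet`). The parameters `(y, σ)` fill only a small set, whereas the property
demands a full space or half-space (`exists_smooth_reparametrization`). Finally, the extension
obtained for `G` is known to agree with the shift function only off the zeros of `G`; density and
continuity give the remaining regular points of `F`. -/

theorem IsIntegralCurveOn.hasDerivAt_affine {F : E → E} {γ : ℝ → E} {J : Set ℝ}
    (hJ : IsOpen J) (hJc : J.OrdConnected) (hγ : IsIntegralCurveOn γ (fun _ => F) J)
    {a b : ℝ} (ha : a ∈ J) (hb : b ∈ J) {r : ℝ} (hr : r ∈ Set.Icc (0 : ℝ) 1) :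
    HasDerivAt (fun r : ℝ => γ (a + r * (b - a))) ((b - a) • F (γ (a + r * (b - a)))) r := by
  have hmem : a + r * (b - a) ∈ J := by
    have := hJc.convex ha hb (by linarith [hr.2] : 0 ≤ 1 - r) hr.1 (by ring)
    convert this using 1
    simp only [smul_eq_mul]
    ring
  have h1 : HasDerivAt γ (F (γ (a + r * (b - a)))) (a + r * (b - a)) :=
    (hγ _ hmem).hasDerivAt (hJ.mem_nhds hmem)
  have h2 : HasDerivAt (fun r : ℝ => a + r * (b - a)) (b - a) r := by
    simpa using ((hasDerivAt_id r).mul_const (b - a)).const_add a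
  exact h1.scomp r h2

/-- Grönwall comparison with the constant solution `z`. The affine change of time to `[0, 1]` treats
forward and backward motion alike; leaving out the endpoint in `hs` allows use up to a first exit
time. -/
theorem IsIntegralCurveOn.dist_le_exp_mul {F : E → E} {γ : ℝ → E} {J : Set ℝ}
    (hJ : IsOpen J) (hJc : J.OrdConnected) (hγ : IsIntegralCurveOn γ (fun _ => F) J)
    {K : NNReal} {s : Set E} (hF : LipschitzOnWith K F s) {z : E} (hz : z ∈ s) (hFz : F z = 0)
    {a b : ℝ} (ha : a ∈ J) (hb : b ∈ J)
    (hs : ∀ r ∈ Set.Ico (0 : ℝ) 1, γ (a + r * (b - a)) ∈ s) :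
    dist (γ b) z ≤ dist (γ a) z * Real.exp (K * |b - a|) := by
  have hd := fun r (hr : r ∈ Set.Icc (0 : ℝ) 1) => hγ.hasDerivAt_affine hJ hJc ha hb hr
  have key := dist_le_of_trajectories_ODE_of_mem (v := fun _ x => (b - a) • F x)
    (K := ‖b - a‖₊ * K) (s := fun _ => s) (a := 0) (b := 1)
    (f := fun r : ℝ => γ (a + r * (b - a))) (g := fun _ => z) (δ := dist (γ a) z)
    (fun _ _ => (lipschitzWith_smul (b - a)).comp_lipschitzOnWith hF)
    (fun r hr => (hd r hr).continuousAt.continuousWithinAt)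
    (fun r hr => (hd r ⟨hr.1, hr.2.le⟩).hasDerivWithinAt) hs continuousOn_const
    (fun r _ => by simpa [hFz] using hasDerivWithinAt_const r (Set.Ici r) z)
    (fun _ _ => hz) (by simp) 1 (by simp)
  simpa [mul_comm] using key

theorem IsIntegralCurveOn.mem_ball_of_small {F : E → E} {γ : ℝ → E} {J : Set ℝ}
    (hJ : IsOpen J) (hJc : J.OrdConnected) (hγ : IsIntegralCurveOn γ (fun _ => F) J)
    {K : NNReal} {z : E} {R C : ℝ} (hF : LipschitzOnWith K F (Metric.ball z R)) (hFz : F z = 0)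
    (h0 : 0 ∈ J) {t : ℝ} (ht : t ∈ J) (htC : |t| ≤ C)
    (hsmall : dist (γ 0) z * Real.exp (K * C) < R) : γ t ∈ Metric.ball z R := by
  have hC : 0 ≤ C := (abs_nonneg t).trans htC
  have hstart : dist (γ 0) z < R :=
    (le_mul_of_one_le_right dist_nonneg (Real.one_le_exp (by positivity))).trans_lt hsmall
  have hR : 0 < R := dist_nonneg.trans_lt hstart
  by_contra hout
  have hd := fun r (hr : r ∈ Set.Icc (0 : ℝ) 1) => hγ.hasDerivAt_affine hJ hJc h0 ht hr
  have hcont : ContinuousOn (fun r : ℝ => dist (γ (0 + r * (t - 0))) z) (Set.Icc 0 1) :=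
    fun r hr => (hd r hr).continuousAt.continuousWithinAt.dist continuousWithinAt_const
  have hclosed : IsCompact (Set.Icc (0 : ℝ) 1 ∩
      (fun r : ℝ => dist (γ (0 + r * (t - 0))) z) ⁻¹' Set.Ici R) :=
    isCompact_Icc.of_isClosed_subset (hcont.preimage_isClosed_of_isClosed isClosed_Icc isClosed_Ici)
      Set.inter_subset_left
  -- `r₁` is the first exit parameter: before it the Lipschitz bound applies, and Grönwall then
  -- forbids reaching distance `R` at `r₁`.
  obtain ⟨r₁, ⟨hr₁, hr₁R⟩, hleast⟩ := hclosed.exists_isLeast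
    ⟨1, by simp, by simpa using hout⟩
  have hmem : r₁ * t ∈ J := by
    have := hJc.convex h0 ht (by linarith [hr₁.2] : 0 ≤ 1 - r₁) hr₁.1 (by ring)
    simpa using this
  have hpos : 0 < r₁ := by
    rcases hr₁.1.lt_or_eq with h | h
    · exact h
    · subst h
      simp only [Set.mem_preimage, Set.mem_Ici, zero_mul, add_zero] at hr₁R
      exact absurd hr₁R (not_le.2 hstart)
  have hle := hγ.dist_le_exp_mul hJ hJc hF (Metric.mem_ball_self hR) hFz h0 hmem (by
    intro r hr
    by_contra hout'
    have h1 : r * r₁ < r₁ := by nlinarith [hr.2]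
    refine absurd (hleast ⟨⟨mul_nonneg hr.1 hr₁.1, h1.le.trans hr₁.2⟩, ?_⟩) (not_le.2 h1)
    simpa [mul_assoc] using hout')
  have hexp : Real.exp (K * |r₁ * t - 0|) ≤ Real.exp (K * C) := by
    apply Real.exp_le_exp.2
    apply mul_le_mul_of_nonneg_left _ K.2
    rw [sub_zero, abs_mul, abs_of_nonneg hr₁.1]
    nlinarith [hr₁.2, abs_nonneg t]
  have h2 : R ≤ dist (γ (r₁ * t)) z := by simpa using hr₁R
  have h3 := mul_le_mul_of_nonneg_left hexp (dist_nonneg : 0 ≤ dist (γ 0) z)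
  linarith

theorem FlowsTo.unique {U : Set E} {F : E → E} (hU : IsOpen U) (hF : ContDiffOn ℝ ∞ F U)
    {x y y' : E} {t : ℝ} (h : FlowsTo U F x t y) (h' : FlowsTo U F x t y') : y = y' := by
  obtain ⟨γ, J, hJ, hJc, h0, ht, hJU, hγ, hγ0, rfl⟩ := h
  obtain ⟨γ', J', hJ', hJc', h0', ht', hJU', hγ', hγ0', rfl⟩ := h'
  have hd := fun r (hr : r ∈ Set.Icc (0 : ℝ) 1) => hγ.hasDerivAt_affine hJ hJc h0 ht hr
  have hd' := fun r (hr : r ∈ Set.Icc (0 : ℝ) 1) => hγ'.hasDerivAt_affine hJ' hJc' h0' ht' hr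
  set f := fun r : ℝ => γ (0 + r * (t - 0))
  set f' := fun r : ℝ => γ' (0 + r * (t - 0))
  have hc : ContinuousOn f (Set.Icc 0 1) := fun r hr => (hd r hr).continuousAt.continuousWithinAt
  have hc' : ContinuousOn f' (Set.Icc 0 1) := fun r hr => (hd' r hr).continuousAt.continuousWithinAt
  have hmem : ∀ (I : Set ℝ), I.OrdConnected → 0 ∈ I → t ∈ I → ∀ r ∈ Set.Icc (0 : ℝ) 1,
      0 + r * (t - 0) ∈ I := by
    intro I hI h0 ht r hr
    have := hI.convex h0 ht (by linarith [hr.2] : 0 ≤ 1 - r) hr.1 (by ring)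
    simpa using this
  have hcomp : IsCompact (f '' Set.Icc 0 1 ∪ f' '' Set.Icc 0 1) :=
    (isCompact_Icc.image_of_continuousOn hc).union (isCompact_Icc.image_of_continuousOn hc')
  have hsub : f '' Set.Icc 0 1 ∪ f' '' Set.Icc 0 1 ⊆ U := by
    rintro _ (⟨r, hr, rfl⟩ | ⟨r, hr, rfl⟩)
    · exact hJU (hmem J hJc h0 ht r hr)
    · exact hJU' (hmem J' hJc' h0' ht' r hr)
  -- `F` is only locally Lipschitz, but the two arcs have compact union, on which one constant
  -- suffices for Grönwall.
  obtain ⟨K, hK⟩ := LocallyLipschitzOn.exists_lipschitzOnWith_of_compact (f := F) hcomp (by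
    intro x hx
    obtain ⟨K, s, hs, hK⟩ := ((hF.contDiffAt (hU.mem_nhds (hsub hx))).of_le
      (by simp : (1 : WithTop ℕ∞) ≤ ∞)).exists_lipschitzOnWith
    exact ⟨K, s, mem_nhdsWithin_of_mem_nhds hs, hK⟩)
  have key := dist_le_of_trajectories_ODE_of_mem (v := fun _ x => (t - 0) • F x)
    (K := ‖t - 0‖₊ * K) (s := fun _ => f '' Set.Icc 0 1 ∪ f' '' Set.Icc 0 1) (a := 0) (b := 1)
    (f := f) (g := f') (δ := 0)
    (fun _ _ => (lipschitzWith_smul (t - 0)).comp_lipschitzOnWith hK) hc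
    (fun r hr => (hd r ⟨hr.1, hr.2.le⟩).hasDerivWithinAt)
    (fun r hr => Or.inl ⟨r, ⟨hr.1, hr.2.le⟩, rfl⟩) hc'
    (fun r hr => (hd' r ⟨hr.1, hr.2.le⟩).hasDerivWithinAt)
    (fun r hr => Or.inr ⟨r, ⟨hr.1, hr.2.le⟩, rfl⟩) (by simp [f, f', hγ0, hγ0']) 1 (by simp)
  simpa [f, f'] using key

theorem flowsTo_self_of_eq_zero {U : Set E} {F : E → E} {x : E} (hx : x ∈ U) (hFx : F x = 0)
    (t : ℝ) : FlowsTo U F x t x :=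
  ⟨fun _ => x, Set.univ, isOpen_univ, Set.ordConnected_univ, trivial, trivial, fun _ _ => hx,
    fun s _ => by simpa [hFx] using hasDerivWithinAt_const s Set.univ x, rfl, rfl⟩

theorem eq_of_mem_flowOrbit_of_eq_zero {U : Set E} {F : E → E} (hU : IsOpen U)
    (hF : ContDiffOn ℝ ∞ F U) {x y : E} (hx : x ∈ U) (hFx : F x = 0) (h : y ∈ flowOrbit U F x) :
    y = x := by
  obtain ⟨t, ht⟩ := h
  exact ht.unique hU hF (flowsTo_self_of_eq_zero hx hFx t)

theorem FlowsTo.mono {U U' : Set E} {F : E → E} {x y : E} {t : ℝ} (hUU' : U ⊆ U')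
    (h : FlowsTo U F x t y) : FlowsTo U' F x t y := by
  obtain ⟨γ, J, hJ, hJc, h0, ht, hJU, hγ⟩ := h
  exact ⟨γ, J, hJ, hJc, h0, ht, hJU.mono_right hUU', hγ⟩

/-- The required open interval is the component of `0` in the set of times at which the curve lies
in `O`. -/
theorem flowsTo_of_forall_mem_uIcc {O : Set E} {F : E → E} (hO : IsOpen O) {γ : ℝ → E}
    {J : Set ℝ} (hJ : IsOpen J) (hJc : J.OrdConnected) (hγ : IsIntegralCurveOn γ (fun _ => F) J)
    (h0 : 0 ∈ J) {t : ℝ} (ht : t ∈ J) (hmem : ∀ s ∈ Set.uIcc 0 t, γ s ∈ O) :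
    FlowsTo O F (γ 0) t (γ t) := by
  have hopen : IsOpen (J ∩ γ ⁻¹' O) := hγ.continuousOn.isOpen_inter_preimage hJ hO
  have hsub : Set.uIcc 0 t ⊆ J ∩ γ ⁻¹' O := fun s hs => ⟨hJc.uIcc_subset h0 ht hs, hmem s hs⟩
  have hcc : Set.uIcc 0 t ⊆ connectedComponentIn (J ∩ γ ⁻¹' O) 0 :=
    isPreconnected_uIcc.subset_connectedComponentIn Set.left_mem_uIcc hsub
  refine ⟨γ, connectedComponentIn (J ∩ γ ⁻¹' O) 0, hopen.connectedComponentIn,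
    isPreconnected_connectedComponentIn.ordConnected, hcc Set.left_mem_uIcc,
    hcc Set.right_mem_uIcc, fun s hs => (connectedComponentIn_subset _ _ hs).2,
    hγ.mono fun s hs => (connectedComponentIn_subset _ _ hs).1, rfl, rfl⟩

/-- Confinement without any bound on the shift times. Times between `0` and `L c₀` are covered by
`h₀`. By the intermediate value theorem every time between `L c₀` and `L c` is some `L c'`, and
there the trajectory is at `w c'`, which lies in `O`. -/
theorem FlowsTo.of_mem_preconnected {Q : Type*} [TopologicalSpace Q] {U O : Set E} {F : E → E}
    (hU : IsOpen U) (hF : ContDiffOn ℝ ∞ F U) (hO : IsOpen O) (hOU : O ⊆ U) {x : E} {T : Set Q}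
    (hT : IsPreconnected T) {L : Q → ℝ} (hL : ContinuousOn L T) {w : Q → E}
    (hw : ∀ c ∈ T, FlowsTo U F x (L c) (w c)) (hwO : ∀ c ∈ T, w c ∈ O)
    {c₀ c : Q} (hc₀ : c₀ ∈ T) (hc : c ∈ T) (h₀ : FlowsTo O F x (L c₀) (w c₀)) :
    FlowsTo O F x (L c) (w c) := by
  obtain ⟨γ, J, hJ, hJc, h0, ht, hJU, hγ, hγ0, hγt⟩ := hw c hc
  have hflow : ∀ s ∈ J, FlowsTo U F x s (γ s) := fun s hs =>
    ⟨γ, J, hJ, hJc, h0, hs, hJU, hγ, hγ0, rfl⟩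
  have hmem : ∀ s ∈ Set.uIcc 0 (L c), γ s ∈ O := by
    intro s hs
    have hsJ : s ∈ J := hJc.uIcc_subset h0 ht hs
    rcases Set.uIcc_subset_uIcc_union_uIcc (b := L c₀) hs with hs' | hs'
    · obtain ⟨γ', J', hJ', hJc', h0', ht', hJO', hγ', hγ0', -⟩ := h₀
      have hsJ' : s ∈ J' := hJc'.uIcc_subset h0' ht' hs'
      have hfl : FlowsTo U F x s (γ' s) :=
        ⟨γ', J', hJ', hJc', h0', hsJ', hJO'.mono_right hOU, hγ', hγ0', rfl⟩
      rw [(hflow s hsJ).unique hU hF hfl]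
      exact hJO' hsJ'
    · obtain ⟨c', hc', rfl⟩ := (hT.image L hL).ordConnected.uIcc_subset
        (Set.mem_image_of_mem L hc₀) (Set.mem_image_of_mem L hc) hs'
      rw [(hflow _ hsJ).unique hU hF (hw c' hc')]
      exact hwO c' hc'
  have := flowsTo_of_forall_mem_uIcc hO hJ hJc hγ h0 ht hmem
  rwa [hγ0, hγt] at this

/-- Grönwall run backwards from `y` to `x`: in bounded time the flow cannot contract distances to a
zero too strongly. -/
theorem FlowsTo.dist_bounds {s : Set E} {F : E → E} {K : NNReal} (hF : LipschitzOnWith K F s)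
    {z : E} (hz : z ∈ s) (hFz : F z = 0) {x y : E} {t : ℝ} (h : FlowsTo s F x t y) :
    dist x z ≤ dist y z * Real.exp (K * |t|) := by
  obtain ⟨γ, J, hJ, hJc, h0, ht, hJU, hγ, rfl, rfl⟩ := h
  have := hγ.dist_le_exp_mul hJ hJc hF hz hFz ht h0 (by
    intro r hr
    apply hJU
    have := hJc.convex ht h0 (by linarith [hr.2] : 0 ≤ 1 - r) hr.1 (by ring)
    convert this using 1
    simp only [smul_eq_mul]
    ring)
  simpa using this

theorem FlowsTo.fst {E₁ E₂ : Type*} [NormedAddCommGroup E₁] [NormedSpace ℝ E₁]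
    [NormedAddCommGroup E₂] [NormedSpace ℝ E₂] {O : Set (E₁ × E₂)} {U : Set E₁}
    {F : E₁ × E₂ → E₁ × E₂} {G : E₁ → E₁} (hFG : ∀ p ∈ O, (F p).1 = G p.1)
    (hOU : Set.MapsTo Prod.fst O U) {p q : E₁ × E₂} {t : ℝ} (h : FlowsTo O F p t q) :
    FlowsTo U G p.1 t q.1 := by
  obtain ⟨γ, J, hJ, hJc, h0, ht, hJU, hγ, rfl, rfl⟩ := h
  refine ⟨fun s => (γ s).1, J, hJ, hJc, h0, ht, fun s hs => hOU (hJU hs), ?_, rfl, rfl⟩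
  intro s hs
  have := (ContinuousLinearMap.fst ℝ E₁ E₂).hasFDerivAt.comp_hasDerivWithinAt s (hγ s hs)
  change HasDerivWithinAt (fun s => (γ s).1) (G (γ s).1) J s
  rw [← hFG _ (hJU hs)]
  exact this

end FlowLemmas

/-! ### Continuity of jets under composition -/

section Jets

/-- By the Faà di Bruno formula, the derivative is a finite sum of terms that are jointly continuous
in the jets of `f` and `g` of order at most `i`. -/
theorem continuousOn_iteratedFDerivWithin_comp_left_right {X X' Y Y' T : Type*}
    [NormedAddCommGroup X] [NormedSpace ℝ X] [NormedAddCommGroup X'] [NormedSpace ℝ X']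
    [NormedAddCommGroup Y] [NormedSpace ℝ Y] [NormedAddCommGroup Y'] [NormedSpace ℝ Y']
    [TopologicalSpace T]
    {s : Set X} {s' : Set X'} (hs : UniqueDiffOn ℝ s) (hs' : UniqueDiffOn ℝ s')
    {f : X → T → Y} (hf : ∀ τ, ContDiffOn ℝ ∞ (fun x => f x τ) s)
    {g : X' → X} (hg : ContDiffOn ℝ ∞ g s') (hmaps : Set.MapsTo g s' s) (A : Y →L[ℝ] Y') (i : ℕ)
    (hjet : ∀ j ≤ i, ContinuousOn (fun q : X × T =>
      iteratedFDerivWithin ℝ j (fun x => f x q.2) s q.1) (s ×ˢ Set.univ)) :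
    ContinuousOn (fun q : X' × T => iteratedFDerivWithin ℝ i (fun x => A (f (g x) q.2)) s' q.1)
      (s' ×ˢ Set.univ) := by
  have hformula : ∀ q ∈ s' ×ˢ (Set.univ : Set T),
      iteratedFDerivWithin ℝ i (fun x => A (f (g x) q.2)) s' q.1 =
        ContinuousLinearMap.compContinuousMultilinearMapL ℝ (fun _ : Fin i => X') Y Y' A
          (∑ c : OrderedFinpartition i, c.compAlongOrderedFinpartitionL ℝ X' X Y
            (iteratedFDerivWithin ℝ c.length (fun x => f x q.2) s (g q.1))
            (fun m => iteratedFDerivWithin ℝ (c.partSize m) g s' q.1)) := by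
    rintro ⟨x, τ⟩ ⟨hx, -⟩
    have h1 : iteratedFDerivWithin ℝ i (A ∘ fun x => f (g x) τ) s' x =
        A.compContinuousMultilinearMap (iteratedFDerivWithin ℝ i (fun x => f (g x) τ) s' x) :=
      A.iteratedFDerivWithin_comp_left (((hf τ).comp hg hmaps) x hx) hs' hx
        (by exact_mod_cast le_top)
    have h2 := (((hf τ).ftaylorSeriesWithin hs).comp (hg.ftaylorSeriesWithin hs')
      hmaps).eq_iteratedFDerivWithin_of_uniqueDiffOn (m := i) (by exact_mod_cast le_top) hs' hx
    change iteratedFDerivWithin ℝ i (A ∘ fun x => f (g x) τ) s' x = _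
    rw [h1]
    change A.compContinuousMultilinearMap
      (iteratedFDerivWithin ℝ i ((fun x => f x τ) ∘ g) s' x) = _
    rw [← h2]
    rfl
  refine ContinuousOn.congr ?_ hformula
  refine (ContinuousLinearMap.continuous _).comp_continuousOn (continuousOn_finsetSum _ ?_)
  intro c _
  have hgq : ContinuousOn (fun q : X' × T => (g q.1, q.2)) (s' ×ˢ Set.univ) :=
    (hg.continuousOn.comp continuousOn_fst fun q hq => hq.1).prodMk continuousOn_snd
  have h1 : ContinuousOn (fun q : X' × T =>
      iteratedFDerivWithin ℝ c.length (fun x => f x q.2) s (g q.1)) (s' ×ˢ Set.univ) :=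
    (hjet c.length c.length_le).comp hgq fun q hq => ⟨hmaps hq.1, trivial⟩
  have h2 : ContinuousOn (fun q : X' × T => fun m : Fin c.length =>
      iteratedFDerivWithin ℝ (c.partSize m) g s' q.1) (s' ×ˢ Set.univ) :=
    continuousOn_pi.2 fun m => (hg.continuousOn_iteratedFDerivWithin
      (by exact_mod_cast le_top) hs').comp continuousOn_fst fun q hq => hq.1
  have h3 := (c.compAlongOrderedFinpartitionL ℝ X' X Y).continuous.comp_continuousOn h1
  have hev : Continuous (fun z : (ContinuousMultilinearMap ℝ
      (fun m : Fin c.length => X' [×c.partSize m]→L[ℝ] X) (X' [×i]→L[ℝ] Y)) ×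
      (∀ m : Fin c.length, X' [×c.partSize m]→L[ℝ] X) => z.1 z.2) := continuous_eval
  exact hev.comp_continuousOn (h3.prodMk h2)

end Jets

/-! ### Criteria for local diffeomorphisms -/

section LocalDiffeomorphisms

theorem IsLocalDiffeomorphAt.surjective_fderiv {E : Type*} [NormedAddCommGroup E]
    [NormedSpace ℝ E] {h : E → E} {x : E} (hh : IsLocalDiffeomorphAt 𝓘(ℝ, E) 𝓘(ℝ, E) ∞ h x) :
    Function.Surjective (fderiv ℝ h x) := by
  have := (hh.mfderivToContinuousLinearEquiv (by simp)).surjective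
  rw [← mfderiv_eq_fderiv]
  exact this

theorem isLocalDiffeomorphAt_of_injective_fderiv {E : Type*} [NormedAddCommGroup E]
    [NormedSpace ℝ E] [FiniteDimensional ℝ E] {h : E → E} {V : Set E} (hV : IsOpen V)
    (hh : ContDiffOn ℝ ∞ h V) {x : E} (hx : x ∈ V) (hinj : Function.Injective (fderiv ℝ h x)) :
    IsLocalDiffeomorphAt 𝓘(ℝ, E) 𝓘(ℝ, E) ∞ h x := by
  have : CompleteSpace E := FiniteDimensional.complete ℝ E
  have hhx : ∀ y ∈ V, ContDiffAt ℝ ∞ h y := fun y hy => hh.contDiffAt (hV.mem_nhds hy)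
  let f' : E ≃L[ℝ] E :=
    (LinearEquiv.ofInjectiveEndo (fderiv ℝ h x : E →ₗ[ℝ] E) hinj).toContinuousLinearEquiv
  have hf' : HasFDerivAt h (f' : E →L[ℝ] E) x := by
    have : (f' : E →L[ℝ] E) = fderiv ℝ h x := by ext v; rfl
    rw [this]
    exact ((hhx x hx).differentiableAt (by simp)).hasFDerivAt
  let e := (hhx x hx).toOpenPartialHomeomorph h hf' (by simp)
  have hfd : ContinuousOn (fderiv ℝ h) V := hh.continuousOn_fderiv_of_isOpen hV (by simp)
  -- Invertibility is an open condition; restricting to `O` makes the local inverse smooth at every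
  -- point of its domain.
  let O : Set E := V ∩ fderiv ℝ h ⁻¹' Set.range ((↑) : (E ≃L[ℝ] E) → E →L[ℝ] E)
  have hO : IsOpen O := hfd.isOpen_inter_preimage hV (ContinuousLinearEquiv.isOpen)
  let e' := e.restrOpen O hO
  have hsrc : e'.source = e.source ∩ O := e.restrOpen_source O hO
  let Φ : PartialDiffeomorph 𝓘(ℝ, E) 𝓘(ℝ, E) E E ∞ :=
    { e'.toPartialEquiv with
      open_source := e'.open_source
      open_target := e'.open_target
      contMDiffOn_toFun := by
        rw [contMDiffOn_iff_contDiffOn]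
        exact hh.mono fun y hy => (hsrc ▸ hy : y ∈ e.source ∩ O).2.1
      contMDiffOn_invFun := by
        rw [contMDiffOn_iff_contDiffOn]
        intro y hy
        have hy' : e'.symm y ∈ e.source ∩ O := hsrc ▸ e'.map_target hy
        obtain ⟨g', hg'⟩ := hy'.2.2
        have hd : HasFDerivAt e' (g' : E →L[ℝ] E) (e'.symm y) := by
          rw [hg']
          exact ((hhx _ hy'.2.1).differentiableAt (by simp)).hasFDerivAt
        exact (e'.contDiffAt_symm hy hd (hhx _ hy'.2.1)).contDiffWithinAt }
  refine ⟨Φ, ?_, fun y _ => rfl⟩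
  change x ∈ e'.source
  rw [hsrc]
  refine ⟨(hhx x hx).mem_toOpenPartialHomeomorph_source hf' (by simp), hx, f', ?_⟩
  exact hf'.fderiv.symm

/-- Along a kernel direction `v` the difference quotients of `h` tend to `0`, while `‖v‖` is at most
`C` times their norms. -/
theorem injective_fderiv_of_dist_le {E : Type*} [NormedAddCommGroup E]
    [NormedSpace ℝ E] {h : E → E} {x : E} (hh : DifferentiableAt ℝ h x) {C : ℝ}
    (hC : ∀ᶠ y in 𝓝 x, ‖y - x‖ ≤ C * ‖h y - h x‖) : Function.Injective (fderiv ℝ h x) := by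
  refine (injective_iff_map_eq_zero _).2 fun v hv => ?_
  have hline : HasDerivAt (fun t : ℝ => x + t • v) v 0 := by
    simpa using ((hasDerivAt_id (0 : ℝ)).smul_const v).const_add x
  have hd : HasDerivAt (fun t : ℝ => h (x + t • v)) 0 0 := by
    have h1 : HasFDerivAt h (fderiv ℝ h x) (x + (0 : ℝ) • v) := by simpa using hh.hasFDerivAt
    simpa [hv, Function.comp_def] using h1.comp_hasDerivAt 0 hline
  have hlim := (hasDerivAt_iff_tendsto_slope_zero.1 hd).norm.const_mul C
  have hcont : Filter.Tendsto (fun t : ℝ => x + t • v) (𝓝[≠] 0) (𝓝 x) := by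
    have := hline.continuousAt.tendsto.mono_left (nhdsWithin_le_nhds (s := {0}ᶜ))
    simpa using this
  have hle : ‖v‖ ≤ C * ‖(0 : E)‖ := by
    refine ge_of_tendsto hlim ?_
    filter_upwards [hcont.eventually hC, self_mem_nhdsWithin] with t ht ht0
    have ht0' : 0 < |t| := abs_pos.2 ht0
    simp only [add_sub_cancel_left, norm_smul, Real.norm_eq_abs] at ht
    simp only [zero_add, zero_smul, add_zero, norm_smul, norm_inv, Real.norm_eq_abs]
    rw [← mul_le_mul_iff_right₀ ht0']
    calc |t| * ‖v‖ ≤ C * ‖h (x + t • v) - h x‖ := ht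
      _ = _ := by field_simp
  simpa using hle

end LocalDiffeomorphisms

/-! ### Parameter spaces and their reparametrization -/

section HalfSpace

theorem convex_halfSpace (l : ℕ) : Convex ℝ (halfSpace l) := by
  intro a ha b hb r s hr hs _ i hi
  have := mul_nonneg hr (ha i hi)
  have := mul_nonneg hs (hb i hi)
  simp only [Pi.add_apply, Pi.smul_apply, smul_eq_mul]
  linarith

theorem halfSpace_mem_nhds {l : ℕ} {σ : Fin l → ℝ} (h : ∀ i : Fin l, (i : ℕ) + 1 = l → 0 < σ i) :
    halfSpace l ∈ 𝓝 σ := by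
  have hev : ∀ᶠ s : Fin l → ℝ in 𝓝 σ, ∀ i : Fin l, (i : ℕ) + 1 = l → 0 < s i := by
    refine Filter.eventually_all.2 fun i => ?_
    by_cases hi : (i : ℕ) + 1 = l
    · filter_upwards [(continuous_apply i).continuousAt.eventually (lt_mem_nhds (h i hi))]
        with s hs _ using hs
    · exact Filter.Eventually.of_forall fun s hi' => absurd hi' hi
  filter_upwards [hev] with s hs i hi using (hs i hi).le

theorem convex_of_eq_univ_or_halfSpace {l : ℕ} {S : Set (Fin l → ℝ)}
    (hS : S = Set.univ ∨ S = halfSpace l) : Convex ℝ S := by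
  rcases hS with rfl | rfl
  · exact convex_univ
  · exact convex_halfSpace l

theorem uniqueDiffOn_of_eq_univ_or_halfSpace {l : ℕ} {S : Set (Fin l → ℝ)}
    (hS : S = Set.univ ∨ S = halfSpace l) : UniqueDiffOn ℝ S := by
  refine uniqueDiffOn_convex (convex_of_eq_univ_or_halfSpace hS) ⟨fun _ => 1, ?_⟩
  rw [mem_interior_iff_mem_nhds]
  rcases hS with rfl | rfl
  · exact Filter.univ_mem
  · exact halfSpace_mem_nhds fun _ _ => one_pos

/-- A scaled `arctan` in each coordinate squeezes a whole space or half-space into a small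
neighbourhood of `(0, σ₀)`; a scaled `tan` inverts it there. A half-space is needed only when `σ₀`
lies on the boundary of `S`. -/
theorem exists_smooth_reparametrization (l n : ℕ) {S : Set (Fin l → ℝ)}
    (hS : S = Set.univ ∨ S = halfSpace l) {σ₀ : Fin l → ℝ} (hσ₀ : σ₀ ∈ S) {ε : ℝ} (hε : 0 < ε) :
    ∃ (S' : Set (Fin (l + n) → ℝ)) (P : (Fin (l + n) → ℝ) → (Fin n → ℝ) × (Fin l → ℝ))
      (Q : (Fin n → ℝ) × (Fin l → ℝ) → (Fin (l + n) → ℝ)) (O : Set ((Fin n → ℝ) × (Fin l → ℝ))),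
      (S' = Set.univ ∨ S' = halfSpace (l + n)) ∧ ContDiff ℝ ∞ P ∧
      Set.MapsTo P S' (Metric.ball 0 ε ×ˢ (S ∩ Metric.ball σ₀ ε)) ∧
      IsOpen O ∧ (0, σ₀) ∈ O ∧ ContDiffOn ℝ ∞ Q O ∧ (∀ p ∈ O, P (Q p) = p) ∧
      ∀ p ∈ O, p.2 ∈ S → Q p ∈ S' := by
  -- The `y`-coordinates come first, so the last coordinate of `σ` stays last and the half-space
  -- condition is preserved.
  let e : Fin n ⊕ Fin l ≃ Fin (l + n) := finSumFinEquiv.trans (finCongr (add_comm n l))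
  have he : ∀ i : Fin l, (e (Sum.inr i) : ℕ) = n + i := fun i => by simp [e, add_comm]
  have hl : ∀ i : Fin n, (e (Sum.inl i) : ℕ) = i := fun i => by simp [e]
  have harctan : ∀ x : ℝ, |Real.arctan x| < 2 := fun x => by
    rw [abs_lt]
    constructor <;> linarith [Real.neg_pi_div_two_lt_arctan x, Real.arctan_lt_pi_div_two x,
      Real.pi_lt_four]
  -- The factor `2` comes from `|arctan| < 2`. On the ball of radius `c` the scaled arguments are
  -- below `1 < π / 2`, where `tan` is smooth and inverted by `arctan`.
  obtain ⟨c, hc, hcε, hcS⟩ : ∃ c : ℝ, 0 < c ∧ 2 * c ≤ ε ∧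
      ((S = halfSpace l ∧ ∃ i : Fin l, (i : ℕ) + 1 = l ∧ σ₀ i = 0) ∨
        Metric.ball σ₀ (2 * c) ⊆ S) := by
    by_cases hb : S = halfSpace l ∧ ∃ i : Fin l, (i : ℕ) + 1 = l ∧ σ₀ i = 0
    · exact ⟨ε / 2, by positivity, by linarith, Or.inl hb⟩
    · have hnhds : S ∈ 𝓝 σ₀ := by
        rcases hS with rfl | rfl
        · exact Filter.univ_mem
        · refine halfSpace_mem_nhds fun i hi => (hσ₀ i hi).lt_of_ne fun h0 => ?_
          exact hb ⟨rfl, i, hi, h0.symm⟩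
      obtain ⟨r, hr, hrS⟩ := Metric.mem_nhds_iff.1 hnhds
      refine ⟨min ε r / 2, by positivity, by linarith [min_le_left ε r], Or.inr ?_⟩
      exact (Metric.ball_subset_ball (by linarith [min_le_right ε r])).trans hrS
  let P : (Fin (l + n) → ℝ) → (Fin n → ℝ) × (Fin l → ℝ) := fun s =>
    (fun i => c * Real.arctan (s (e (Sum.inl i))),
      fun i => σ₀ i + c * Real.arctan (s (e (Sum.inr i))))
  let Q : (Fin n → ℝ) × (Fin l → ℝ) → (Fin (l + n) → ℝ) := fun p j =>
    Sum.elim (fun i => Real.tan (p.1 i / c)) (fun i => Real.tan ((p.2 i - σ₀ i) / c)) (e.symm j)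
  have hQr : ∀ p i, Q p (e (Sum.inr i)) = Real.tan ((p.2 i - σ₀ i) / c) := fun p i => by
    simp [Q]
  have hQl : ∀ p i, Q p (e (Sum.inl i)) = Real.tan (p.1 i / c) := fun p i => by
    simp [Q]
  have hP : ContDiff ℝ ∞ P := by
    refine (contDiff_pi.2 fun i => ?_).prodMk (contDiff_pi.2 fun i => ?_)
    · exact contDiff_const.mul (Real.contDiff_arctan.comp (contDiff_apply ℝ ℝ _))
    · exact contDiff_const.add
        (contDiff_const.mul (Real.contDiff_arctan.comp (contDiff_apply ℝ ℝ _)))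
  have hmul : ∀ x : ℝ, |c * Real.arctan x| < 2 * c := fun x => by
    rw [abs_mul, abs_of_pos hc]
    nlinarith [harctan x]
  have hP1 : ∀ s, (P s).1 ∈ Metric.ball 0 ε := fun s => by
    rw [Metric.mem_ball, dist_pi_lt_iff hε]
    intro i
    simpa [P, Real.dist_eq] using (hmul _).trans_le hcε
  have hP2 : ∀ s, (P s).2 ∈ Metric.ball σ₀ (2 * c) := fun s => by
    rw [Metric.mem_ball, dist_pi_lt_iff (by positivity)]
    intro i
    simpa [P, Real.dist_eq] using hmul _
  have hO : ∀ p ∈ Metric.ball ((0 : Fin n → ℝ), σ₀) c,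
      (∀ i, |p.1 i / c| < 1) ∧ ∀ i, |(p.2 i - σ₀ i) / c| < 1 := by
    intro p hp
    rw [Metric.mem_ball, Prod.dist_eq, max_lt_iff, dist_pi_lt_iff hc, dist_pi_lt_iff hc] at hp
    refine ⟨fun i => ?_, fun i => ?_⟩
    · rw [abs_div, abs_of_pos hc, div_lt_one hc]
      simpa [Real.dist_eq] using hp.1 i
    · rw [abs_div, abs_of_pos hc, div_lt_one hc]
      simpa [Real.dist_eq] using hp.2 i
  have hcos : ∀ x : ℝ, |x| < 1 → Real.cos x ≠ 0 := fun x hx => by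
    rw [abs_lt] at hx
    exact (Real.cos_pos_of_mem_Ioo
      ⟨by linarith [Real.pi_gt_three], by linarith [Real.pi_gt_three]⟩).ne'
  have hQ : ContDiffOn ℝ ∞ Q (Metric.ball ((0 : Fin n → ℝ), σ₀) c) := by
    refine contDiffOn_pi.2 fun j => ?_
    obtain ⟨k, rfl⟩ := e.surjective j
    intro p hp
    refine ContDiffAt.contDiffWithinAt ?_
    rcases k with i | i
    · simp only [hQl]
      refine ContDiffAt.comp (g := Real.tan) p
        (Real.contDiffAt_tan.2 (hcos _ ((hO p hp).1 i))) ?_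
      exact (((contDiff_apply ℝ ℝ i).comp contDiff_fst).div_const c).contDiffAt
    · simp only [hQr]
      refine ContDiffAt.comp (g := Real.tan) p
        (Real.contDiffAt_tan.2 (hcos _ ((hO p hp).2 i))) ?_
      exact ((((contDiff_apply ℝ ℝ i).comp contDiff_snd).sub contDiff_const).div_const
        c).contDiffAt
  have htan : ∀ x : ℝ, |x| < 1 → Real.arctan (Real.tan x) = x := fun x hx => by
    rw [abs_lt] at hx
    exact Real.arctan_tan (by linarith [Real.pi_gt_three]) (by linarith [Real.pi_gt_three])
  have hPQ : ∀ p ∈ Metric.ball ((0 : Fin n → ℝ), σ₀) c, P (Q p) = p := by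
    intro p hp
    refine Prod.ext (funext fun i => ?_) (funext fun i => ?_)
    · simp only [P, hQl]
      rw [htan _ ((hO p hp).1 i)]
      field_simp
    · simp only [P, hQr]
      rw [htan _ ((hO p hp).2 i)]
      field_simp
      ring
  rcases hcS with ⟨rfl, i₀, hi₀, hσi₀⟩ | hball
  · refine ⟨halfSpace (l + n), P, Q, Metric.ball (0, σ₀) c, Or.inr rfl, hP, fun s hs => ?_,
      Metric.isOpen_ball, Metric.mem_ball_self hc, hQ, hPQ, fun p hp hpS => ?_⟩
    · refine ⟨hP1 s, fun i hi => ?_, Metric.ball_subset_ball hcε (hP2 s)⟩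
      have h1 : 0 ≤ Real.arctan (s (e (Sum.inr i))) :=
        Real.arctan_nonneg.2 (hs _ (by rw [he]; omega))
      have h2 := hσ₀ i hi
      simp only [P]
      positivity
    · intro j hj
      have hji : j = e (Sum.inr i₀) := Fin.ext (by rw [he]; omega)
      rw [hji, hQr, hσi₀, sub_zero]
      have h1 := abs_lt.1 ((hO p hp).2 i₀)
      rw [hσi₀, sub_zero] at h1
      exact Real.tan_nonneg_of_nonneg_of_le_pi_div_two (div_nonneg (hpS i₀ hi₀) hc.le)
        (by linarith [Real.pi_gt_three])
  · exact ⟨Set.univ, P, Q, Metric.ball (0, σ₀) c, Or.inl rfl, hP,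
      fun s _ => ⟨hP1 s, hball (hP2 s), Metric.ball_subset_ball hcε (hP2 s)⟩,
      Metric.isOpen_ball, Metric.mem_ball_self hc, hQ, hPQ, fun p _ _ => trivial⟩

end HalfSpace

/-! ### Confining the trajectories of a deformation near a singular point -/

section Localization

theorem isOpen_diff_singularSet {E : Type*} [NormedAddCommGroup E] [NormedSpace ℝ E]
    {U V : Set E} {F : E → E} (hF : ContinuousOn F U) (hV : IsOpen V) (hVU : V ⊆ U) :
    IsOpen (V \ singularSet U F) := by
  have : V \ singularSet U F = V ∩ F ⁻¹' {0}ᶜ := by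
    ext x
    simp only [singularSet, Set.mem_sdiff, Set.mem_ofPred_eq, Set.mem_inter_iff, Set.mem_preimage,
      Set.mem_compl_iff, Set.mem_singleton_iff]
    exact ⟨fun h => ⟨h.1, fun h' => h.2 ⟨hVU h.1, h'⟩⟩, fun h => ⟨h.1, fun h' => h.2 h'.2⟩⟩
  rw [this]
  exact (hF.mono hVU).isOpen_inter_preimage hV isOpen_compl_singleton

/-- Near a singular point, the trajectories along which a deformation with a continuous shift
function moves the points stay near that singular point. -/
theorem IsDeformation.exists_ball_flowsTo {E P T : Type*} [NormedAddCommGroup E]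
    [NormedSpace ℝ E] [CompleteSpace E] [NormedAddCommGroup P] [NormedSpace ℝ P]
    [TopologicalSpace T] [CompactSpace T] [PreconnectedSpace T]
    {U O V : Set E} {F : E → E} (hU : IsOpen U) (hF : ContDiffOn ℝ ∞ F U) {z : E}
    (hz : z ∈ U) (hFz : F z = 0) (hO : IsOpen O) (hzO : z ∈ O) (hOU : O ⊆ U)
    (hV : IsOpen V) (hzV : z ∈ V) {S : Set P} (hS : Convex ℝ S) {k : ℕ∞}
    {Ω : E → P → T → E} (hΩ : IsDeformation V S k (endoSet U F V) Ω)
    {σ₀ : P} (hσ₀ : σ₀ ∈ S) {τ₀ : T} {α : E → ℝ} (hα : ContinuousOn α V)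
    (hαΩ : ∀ x ∈ V, FlowsTo U F x (α x) (Ω x σ₀ τ₀)) {L : E → P → T → ℝ}
    (hL : ContinuousOn (fun q : (E × P) × T => L q.1.1 q.1.2 q.2)
      (((V \ singularSet U F) ×ˢ S) ×ˢ Set.univ))
    (hLΩ : ∀ x ∈ V \ singularSet U F, ∀ σ ∈ S, ∀ τ, FlowsTo U F x (L x σ τ) (Ω x σ τ))
    (hLα : ∀ x ∈ V \ singularSet U F, L x σ₀ τ₀ = α x) :
    ∃ δ > 0, Metric.ball z δ ⊆ V ∧
      (∀ x ∈ Metric.ball z δ, FlowsTo O F x (α x) (Ω x σ₀ τ₀)) ∧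
      ∀ x ∈ Metric.ball z δ \ singularSet U F, ∀ σ ∈ S ∩ Metric.ball σ₀ δ, ∀ τ,
        FlowsTo O F x (L x σ τ) (Ω x σ τ) := by
  obtain ⟨K, s, hs, hK⟩ := ((hF.contDiffAt (hU.mem_nhds hz)).of_le
    (by simp : (1 : WithTop ℕ∞) ≤ ∞)).exists_lipschitzOnWith
  obtain ⟨R, hR, hRs⟩ := Metric.mem_nhds_iff.1 (Filter.inter_mem hs (hO.mem_nhds hzO))
  have hRO : Metric.ball z R ⊆ O := fun x hx => (hRs hx).2
  have hKR : LipschitzOnWith K F (Metric.ball z R) := hK.mono fun x hx => (hRs hx).1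
  set C : ℝ := |α z| + 1
  have hαC : ∀ᶠ x in 𝓝 z, |α x| ≤ C := by
    have hcont : ContinuousAt (fun x => |α x|) z := (hα.continuousAt (hV.mem_nhds hzV)).abs
    exact (hcont.eventually (gt_mem_nhds (lt_add_one _))).mono fun x hx => le_of_lt hx
  have hsmall : ∀ᶠ x in 𝓝 z, dist x z * Real.exp (K * C) < R := by
    have hcont : Continuous (fun x => dist x z * Real.exp (K * C)) := by fun_prop
    exact hcont.continuousAt.eventually (gt_mem_nhds (by simpa using hR))
  have hfix : ∀ τ, Ω z σ₀ τ = z := fun τ =>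
    eq_of_mem_flowOrbit_of_eq_zero hU hF hz hFz ((hΩ.mem σ₀ hσ₀ τ).2.2.1 z hzV)
  obtain ⟨M, hM, hMeq⟩ := continuousOn_iff'.1 hΩ.continuousOn (Metric.ball z R)
    Metric.isOpen_ball
  -- Since `z` is fixed for all `τ` and `T` is compact, one neighbourhood of `(z, σ₀)` is carried
  -- into the ball for all `τ` at once.
  obtain ⟨u, v, hu, -, hzu, huniv, huv⟩ := generalized_tube_lemma
    (isCompact_singleton (x := (z, σ₀))) (isCompact_univ (X := T)) hM (by
      rintro ⟨_, τ⟩ ⟨rfl, -⟩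
      have : ((z, σ₀), τ) ∈ (fun q : (E × P) × T => Ω q.1.1 q.1.2 q.2) ⁻¹' Metric.ball z R ∩
          (V ×ˢ S) ×ˢ Set.univ :=
        ⟨by simp [hfix, hR], ⟨hzV, hσ₀⟩, trivial⟩
      exact (hMeq ▸ this).1)
  obtain ⟨ρ, hρ, hρu⟩ := Metric.mem_nhds_iff.1 (hu.mem_nhds (hzu rfl))
  obtain ⟨δ', hδ', hδ'sub⟩ := Metric.eventually_nhds_iff_ball.1
    ((hαC.and hsmall).and (hV.mem_nhds hzV))
  have hα' : ∀ x ∈ Metric.ball z δ', FlowsTo (Metric.ball z R) F x (α x) (Ω x σ₀ τ₀) := by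
    intro x hx
    obtain ⟨⟨hxC, hxR⟩, hxV⟩ := hδ'sub x hx
    obtain ⟨γ, J, hJ, hJc, h0, ht, hJU, hγ, hγ0, hγt⟩ := hαΩ x hxV
    rw [← hγ0] at hxR
    have := flowsTo_of_forall_mem_uIcc Metric.isOpen_ball hJ hJc hγ h0 ht fun r hr =>
      hγ.mem_ball_of_small hJ hJc hKR hFz h0 (hJc.uIcc_subset h0 ht hr) (C := C)
        (le_trans (by simpa using Set.abs_sub_left_of_mem_uIcc hr) hxC) hxR
    rwa [hγ0, hγt] at this
  refine ⟨min ρ δ', lt_min hρ hδ', fun x hx => (hδ'sub x ?_).2, fun x hx => ?_, ?_⟩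
  · exact Metric.ball_subset_ball (min_le_right _ _) hx
  · exact (hα' x (Metric.ball_subset_ball (min_le_right _ _) hx)).mono hRO
  rintro x ⟨hx, hxs⟩ σ hσ τ
  have hx' : x ∈ Metric.ball z δ' := Metric.ball_subset_ball (min_le_right _ _) hx
  have hxV : x ∈ V := (hδ'sub x hx').2
  have hT : IsPreconnected ((S ∩ Metric.ball σ₀ (min ρ δ')) ×ˢ (Set.univ : Set T)) :=
    ((hS.inter (convex_ball _ _)).isPreconnected).prod isPreconnected_univ
  have hσ₀' : σ₀ ∈ S ∩ Metric.ball σ₀ (min ρ δ') :=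
    ⟨hσ₀, Metric.mem_ball_self (lt_min hρ hδ')⟩
  -- At `(σ₀, τ₀)` the time is `α x`, which is bounded near `z`, so Grönwall confines that
  -- trajectory; connectedness of the parameters transfers this to `(σ, τ)`.
  refine FlowsTo.mono hRO (FlowsTo.of_mem_preconnected (L := fun c : P × T => L x c.1 c.2)
    (w := fun c : P × T => Ω x c.1 c.2) (c₀ := (σ₀, τ₀)) (c := (σ, τ)) hU hF Metric.isOpen_ball
    (hRO.trans hOU) hT ?_ ?_ ?_ ⟨hσ₀', trivial⟩ ⟨hσ, trivial⟩ ?_)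
  · have hc : Continuous (fun c : P × T => ((x, c.1), c.2)) := by fun_prop
    exact hL.comp hc.continuousOn fun c hc => ⟨⟨⟨hxV, hxs⟩, hc.1.1⟩, trivial⟩
  · exact fun c hc => hLΩ x ⟨hxV, hxs⟩ c.1 hc.1.1 c.2
  · intro c hc
    have hxu : (x, c.1) ∈ u := hρu (by
      rw [Metric.mem_ball, Prod.dist_eq]
      exact max_lt (lt_of_lt_of_le hx (min_le_left _ _))
        (lt_of_lt_of_le hc.1.2 (min_le_left _ _)))
    have h1 : ((x, c.1), c.2) ∈ M ∩ (V ×ˢ S) ×ˢ Set.univ :=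
      ⟨huv ⟨hxu, huniv trivial⟩, ⟨hxV, hc.1.1⟩, trivial⟩
    rw [← hMeq] at h1
    exact h1.1
  · simpa only [hLα x ⟨hxV, hxs⟩] using hα' x hx'

end Localization

/-! ### Derivatives and nowhere dense sets in products -/

section Products

/-- By `hconst` the derivative is block triangular. Its surjectivity forces the diagonal block on
`E₁` to be surjective, hence injective in finite dimension. -/
theorem injective_fderiv_fst_of_surjective {E₁ E₂ : Type*} [NormedAddCommGroup E₁]
    [NormedSpace ℝ E₁] [FiniteDimensional ℝ E₁] [NormedAddCommGroup E₂] [NormedSpace ℝ E₂]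
    {h : E₁ × E₂ → E₁ × E₂} {x : E₁} {y : E₂} (hd : DifferentiableAt ℝ h (x, y))
    (hsurj : Function.Surjective (fderiv ℝ h (x, y))) (hconst : ∀ᶠ y' in 𝓝 y, (h (x, y')).1 = x) :
    Function.Injective (fderiv ℝ (fun x' => (h (x', y)).1) x) := by
  have h1 : HasFDerivAt (fun x' => (h (x', y)).1)
      ((ContinuousLinearMap.fst ℝ E₁ E₂).comp
        ((fderiv ℝ h (x, y)).comp (ContinuousLinearMap.inl ℝ E₁ E₂))) x :=
    (ContinuousLinearMap.fst ℝ E₁ E₂).hasFDerivAt.comp x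
      (hd.hasFDerivAt.comp x (hasFDerivAt_prodMk_left x y))
  have h2 : HasFDerivAt (fun y' => (h (x, y')).1)
      ((ContinuousLinearMap.fst ℝ E₁ E₂).comp
        ((fderiv ℝ h (x, y)).comp (ContinuousLinearMap.inr ℝ E₁ E₂))) y :=
    (ContinuousLinearMap.fst ℝ E₁ E₂).hasFDerivAt.comp y
      (hd.hasFDerivAt.comp y (hasFDerivAt_prodMk_right x y))
  have h3 := h2.unique ((hasFDerivAt_const x y).congr_of_eventuallyEq hconst)
  rw [h1.fderiv]
  refine LinearMap.injective_iff_surjective (f := (ContinuousLinearMap.toLinearMap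
    ((ContinuousLinearMap.fst ℝ E₁ E₂).comp
        ((fderiv ℝ h (x, y)).comp (ContinuousLinearMap.inl ℝ E₁ E₂))))).2 fun v => ?_
  obtain ⟨⟨a, b⟩, hab⟩ := hsurj (v, 0)
  refine ⟨a, ?_⟩
  have hb : (fderiv ℝ h (x, y) (0, b)).1 = 0 := by
    simpa using DFunLike.congr_fun h3 b
  have hsum : fderiv ℝ h (x, y) (a, b) =
      fderiv ℝ h (x, y) (a, 0) + fderiv ℝ h (x, y) (0, b) := by
    rw [← map_add]
    simp
  have := congrArg Prod.fst (hsum.symm.trans hab)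
  simpa [hb] using this

theorem IsNowhereDense.preimage_fst {X Y : Type*} [TopologicalSpace X] [TopologicalSpace Y]
    {s : Set X} (hs : IsNowhereDense s) : IsNowhereDense (Prod.fst ⁻¹' s : Set (X × Y)) := by
  rw [IsNowhereDense, ← isOpenMap_fst.preimage_closure_eq_closure_preimage continuous_fst,
    ← isOpenMap_fst.preimage_interior_eq_interior_preimage continuous_fst, hs, Set.preimage_empty]

theorem IsNowhereDense.neBot_nhdsWithin_compl {X : Type*} [TopologicalSpace X] {s N : Set X}
    (hs : IsNowhereDense (s ∩ N)) {x : X} (hN : N ∈ 𝓝 x) : (𝓝[sᶜ] x).NeBot := by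
  rw [← mem_closure_iff_nhdsWithin_neBot, closure_compl, Set.mem_compl_iff,
    mem_interior_iff_mem_nhds]
  intro h
  have : x ∈ interior (closure (s ∩ N)) :=
    mem_interior_iff_mem_nhds.2 (Filter.mem_of_superset (Filter.inter_mem h hN) subset_closure)
  rw [hs] at this
  exact this

end Products

/-! ### From deformations for `F` to deformations for `G` -/

theorem IsRegularExtension.exists_radius {m n : ℕ}
    {UG : Set (Fin m → ℝ)} {G : (Fin m → ℝ) → (Fin m → ℝ)}
    (hUG : IsOpen UG) (hUG0 : 0 ∈ UG) (hG : ContDiffOn ℝ ∞ G UG)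
    {UF : Set ((Fin m → ℝ) × (Fin n → ℝ))}
    {F : (Fin m → ℝ) × (Fin n → ℝ) → (Fin m → ℝ) × (Fin n → ℝ)}
    (hUF : IsOpen UF) (hUF0 : 0 ∈ UF) (hext : IsRegularExtension F G) :
    ∃ R > 0, Metric.ball 0 R ⊆ UF ∧ Metric.ball 0 R ⊆ UG ∧
      (∀ p ∈ Metric.ball 0 R, (F p).1 = G p.1) ∧
      ∃ K, LipschitzOnWith K G (Metric.ball 0 R) := by
  obtain ⟨H, B, hB, hB0, -, hFB⟩ := hext
  obtain ⟨K, s, hs, hK⟩ := ((hG.contDiffAt (hUG.mem_nhds hUG0)).of_le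
    (by simp : (1 : WithTop ℕ∞) ≤ ∞)).exists_lipschitzOnWith
  obtain ⟨R₁, hR₁, h₁⟩ := Metric.mem_nhds_iff.1
    (Filter.inter_mem (hUF.mem_nhds hUF0) (hB.mem_nhds hB0))
  obtain ⟨R₂, hR₂, h₂⟩ := Metric.mem_nhds_iff.1 (Filter.inter_mem (hUG.mem_nhds hUG0) hs)
  have h₁' := (Metric.ball_subset_ball (min_le_left R₁ R₂)).trans h₁
  have h₂' := (Metric.ball_subset_ball (min_le_right R₁ R₂)).trans h₂
  exact ⟨min R₁ R₂, lt_min hR₁ hR₂, fun p hp => (h₁' hp).1, fun p hp => (h₂' hp).1,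
    fun p hp => by rw [hFB p (h₁' hp).2], K, hK.mono fun p hp => (h₂' hp).2⟩

/-- A map in `𝓔(F, V)` that moves the nonsingular points near the origin along nearby trajectories
of a regular extension `F` of `G` induces maps in `𝓔(G, V')` on horizontal slices. -/
theorem fst_comp_slice_mem_endoSet {m n : ℕ}
    {UG : Set (Fin m → ℝ)} {G : (Fin m → ℝ) → (Fin m → ℝ)}
    (hUG : IsOpen UG) (hG : ContDiffOn ℝ ∞ G UG)
    {UF : Set ((Fin m → ℝ) × (Fin n → ℝ))}
    {F : (Fin m → ℝ) × (Fin n → ℝ) → (Fin m → ℝ) × (Fin n → ℝ)}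
    (hUF : IsOpen UF) (hF : ContDiffOn ℝ ∞ F UF) {R : ℝ}
    (hRG : Metric.ball 0 R ⊆ UG)
    (hFG : ∀ p ∈ Metric.ball 0 R, (F p).1 = G p.1)
    {K : NNReal} (hK : LipschitzOnWith K G (Metric.ball 0 R))
    {V : Set ((Fin m → ℝ) × (Fin n → ℝ))} (hV : IsOpen V)
    (hVU : V ⊆ UF)
    {h : (Fin m → ℝ) × (Fin n → ℝ) → (Fin m → ℝ) × (Fin n → ℝ)} (hh : h ∈ endoSet UF F V)
    {L : (Fin m → ℝ) × (Fin n → ℝ) → ℝ} (hL : ContinuousOn L (V \ singularSet UF F))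
    {δ : ℝ} (hδR : δ ≤ R) (hδV : Metric.ball 0 δ ⊆ V)
    (hflow : ∀ p ∈ Metric.ball 0 δ \ singularSet UF F,
      FlowsTo (Metric.ball 0 R) F p (L p) (h p))
    {y : Fin n → ℝ} (hy : y ∈ Metric.ball 0 δ) :
    (fun x => (h (x, y)).1) ∈ endoSet UG G (Metric.ball 0 δ) := by
  have hprod : ∀ (r : ℝ) {x : Fin m → ℝ} {y : Fin n → ℝ}, x ∈ Metric.ball 0 r →
      y ∈ Metric.ball 0 r → (x, y) ∈ Metric.ball (0 : (Fin m → ℝ) × (Fin n → ℝ)) r := by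
    intro r x y hx hy
    rw [Metric.mem_ball, Prod.dist_eq]
    exact max_lt hx hy
  have hballfst : ∀ r : ℝ, Set.MapsTo Prod.fst
      (Metric.ball (0 : (Fin m → ℝ) × (Fin n → ℝ)) r) (Metric.ball 0 r) := by
    intro r p hp
    rw [Metric.mem_ball, Prod.dist_eq, max_lt_iff] at hp
    exact hp.1
  have hδUG : Metric.ball 0 δ ⊆ UG := (Metric.ball_subset_ball hδR).trans hRG
  have horbit : ∀ x ∈ Metric.ball 0 δ, ∀ y ∈ Metric.ball 0 δ,
      (h (x, y)).1 ∈ flowOrbit UG G x := by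
    intro x hx y hy
    have hxy := hprod δ hx hy
    by_cases hs : (x, y) ∈ singularSet UF F
    · have heq := eq_of_mem_flowOrbit_of_eq_zero hUF hF hs.1 hs.2 (hh.2.2.1 _ (hδV hxy))
      have hGx : G x = 0 := by
        rw [← hFG (x, y) (Metric.ball_subset_ball hδR hxy), hs.2]
        rfl
      rw [heq]
      exact ⟨0, flowsTo_self_of_eq_zero (hδUG hx) hGx 0⟩
    · exact ⟨_, ((hflow _ ⟨hxy, hs⟩).fst hFG (hballfst R)).mono hRG⟩
  have hmaps : Set.MapsTo (fun x => (x, y)) (Metric.ball (0 : Fin m → ℝ) δ) V :=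
    fun x hx => hδV (hprod δ hx hy)
  have hsmooth : ContDiffOn ℝ ∞ (fun x => (h (x, y)).1) (Metric.ball 0 δ) :=
    contDiff_fst.comp_contDiffOn (hh.1.comp (contDiff_id.prodMk contDiff_const).contDiffOn hmaps)
  refine ⟨hsmooth, fun x hx => ?_, fun x hx => horbit x hx y hy, ?_⟩
  · obtain ⟨t, γ, J, -, -, -, ht, hJU, -, -, hγt⟩ := horbit x hx y hy
    have := hJU ht
    rwa [hγt] at this
  rintro x ⟨hxs, hx⟩
  have hfix : ∀ y ∈ Metric.ball 0 δ, (h (x, y)).1 = x := fun y hy =>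
    eq_of_mem_flowOrbit_of_eq_zero hUG hG hxs.1 hxs.2 (horbit x hx y hy)
  refine isLocalDiffeomorphAt_of_injective_fderiv Metric.isOpen_ball hsmooth hx ?_
  by_cases hs : (x, y) ∈ singularSet UF F
  · refine injective_fderiv_fst_of_surjective ?_
      (hh.2.2.2 _ ⟨hs, hmaps hx⟩).surjective_fderiv ?_
    · exact (hh.1.contDiffAt (hV.mem_nhds (hmaps hx))).differentiableAt (by simp)
    · filter_upwards [Metric.isOpen_ball.mem_nhds hy] with y' hy' using hfix y' hy'
  -- Here `G x = 0` but `F (x, y) ≠ 0`, so membership in `𝓔(F, V)` gives no derivative information.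
  -- Instead `L` is continuous at `(x, y)`, hence locally bounded, and backward Grönwall for `G`
  -- bounds `‖x' - x‖` by a multiple of the displacement of the image from `x`.
  have hopen : IsOpen (V \ singularSet UF F) := isOpen_diff_singularSet hF.continuousOn hV hVU
  have hLc : ContinuousAt (fun x' => L (x', y)) x :=
    ContinuousAt.comp (g := L) (hL.continuousAt (hopen.mem_nhds ⟨hmaps hx, hs⟩))
      (by fun_prop)
  have hev : ∀ᶠ x' in 𝓝 x, (x', y) ∈ V \ singularSet UF F :=
    (by fun_prop : ContinuousAt (fun x' => (x', y)) x).eventually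
      (hopen.mem_nhds ⟨hmaps hx, hs⟩)
  refine injective_fderiv_of_dist_le
    ((hsmooth.contDiffAt (Metric.isOpen_ball.mem_nhds hx)).differentiableAt (by simp))
    (C := Real.exp (K * (|L (x, y)| + 1))) ?_
  filter_upwards [hev, hLc.abs.eventually (gt_mem_nhds (lt_add_one _)),
    Metric.isOpen_ball.mem_nhds hx] with x' hx' hLx' hx'δ
  have hfl := (hflow _ ⟨hprod δ hx'δ hy, hx'.2⟩).fst hFG (hballfst R)
  have hle := hfl.dist_bounds hK (Metric.ball_subset_ball hδR hx) hxs.2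
  rw [hfix y hy, ← dist_eq_norm, ← dist_eq_norm, mul_comm]
  refine hle.trans (mul_le_mul_of_nonneg_left (Real.exp_le_exp.2 ?_) dist_nonneg)
  exact mul_le_mul_of_nonneg_left hLx'.le K.2

theorem mainTheorem11 (m n l d : ℕ) (k : ℕ∞)
    (UG : Set (Fin m → ℝ)) (G : (Fin m → ℝ) → (Fin m → ℝ))
    (hUG : IsOpen UG) (hUG0 : 0 ∈ UG) (hG : ContDiffOn ℝ ∞ G UG)
    (UF : Set ((Fin m → ℝ) × (Fin n → ℝ)))
    (F : (Fin m → ℝ) × (Fin n → ℝ) → (Fin m → ℝ) × (Fin n → ℝ))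
    (hUF : IsOpen UF) (hUF0 : 0 ∈ UF) (hF : ContDiffOn ℝ ∞ F UF)
    (hext : IsRegularExtension F G) (hF0 : F 0 = 0)
    (hES : HasES UG G 0 (l + n) d k) :
    HasES UF F 0 l d k := by
  obtain ⟨hG0, ⟨N, hN, hNd⟩, hES⟩ := hES
  obtain ⟨R, hR, hRF, hRG, hFG, K, hK⟩ := hext.exists_radius hUG hUG0 hG hUF hUF0
  have hprod : ∀ (r : ℝ) {x : Fin m → ℝ} {y : Fin n → ℝ}, x ∈ Metric.ball 0 r →
      y ∈ Metric.ball 0 r → (x, y) ∈ Metric.ball (0 : (Fin m → ℝ) × (Fin n → ℝ)) r := by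
    intro r x y hx hy
    rw [Metric.mem_ball, Prod.dist_eq]
    exact max_lt hx hy
  have hballfst : ∀ r : ℝ, Set.MapsTo Prod.fst
      (Metric.ball (0 : (Fin m → ℝ) × (Fin n → ℝ)) r) (Metric.ball 0 r) := by
    intro r p hp
    rw [Metric.mem_ball, Prod.dist_eq, max_lt_iff] at hp
    exact hp.1
  have hsing : ∀ p ∈ Metric.ball 0 R, p ∈ singularSet UF F → p.1 ∈ singularSet UG G := by
    intro p hp hps
    refine ⟨hRG (hballfst R hp), ?_⟩
    rw [← hFG p hp, hps.2]
    rfl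
  refine ⟨⟨hUF0, hF0⟩, ⟨Prod.fst ⁻¹' N ∩ Metric.ball 0 R, Filter.inter_mem
    (continuous_fst.continuousAt.preimage_mem_nhds hN) (Metric.ball_mem_nhds _ hR),
    IsNowhereDense.mono ?_ hNd.preimage_fst⟩, ?_⟩
  · exact fun p hp => ⟨hsing p hp.2.2 hp.1, hp.2.1⟩
  intro V hV _ h0V hVU S hS Ω hΩ σ₀ hσ₀ τ₀ α hα hαΩ L hL hLΩ hLα
  obtain ⟨R', hR', hR'N⟩ := Metric.mem_nhds_iff.1 hN
  obtain ⟨δ₁, hδ₁, hδ₁V, hδ₁α, hδ₁L⟩ := hΩ.exists_ball_flowsTo hUF hF hUF0 hF0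
    Metric.isOpen_ball (Metric.mem_ball_self hR) hRF hV h0V
    (convex_of_eq_univ_or_halfSpace hS) hσ₀ hα.continuousOn hαΩ hL hLΩ hLα
  obtain ⟨δ, hδ, hδδ₁, hδR, hδR'⟩ : ∃ δ > 0, δ ≤ δ₁ ∧ δ ≤ R ∧ δ ≤ R' :=
    ⟨min δ₁ (min R R'), by positivity, by simp, by simp, by simp⟩
  have hδV : Metric.ball 0 δ ⊆ V := (Metric.ball_subset_ball hδδ₁).trans hδ₁V
  have hδUG : Metric.ball 0 δ ⊆ UG := (Metric.ball_subset_ball hδR).trans hRG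
  obtain ⟨S', P, Q, O, hS', hP, hPS, hO, hO0, hQ, hPQ, hQS⟩ :=
    exists_smooth_reparametrization l n hS hσ₀ hδ
  have hreg : ∀ (x : Fin m → ℝ) (y : Fin n → ℝ), x ∈ Metric.ball 0 δ \ singularSet UG G →
      y ∈ Metric.ball 0 δ → (x, y) ∈ V \ singularSet UF F := by
    intro x y hx hy
    have hxy := hprod δ hx.1 hy
    exact ⟨hδV hxy, fun h => hx.2 (hsing _ (Metric.ball_subset_ball hδR hxy) h)⟩
  have hVs : IsOpen (V \ singularSet UF F) := isOpen_diff_singularSet hF.continuousOn hV hVU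
  -- `g` reads the enlarged parameter as a pair `(y, σ)` and moves `y` back into the point.
  let g : (Fin m → ℝ) × (Fin (l + n) → ℝ) → ((Fin m → ℝ) × (Fin n → ℝ)) × (Fin l → ℝ) :=
    fun q => ((q.1, (P q.2).1), (P q.2).2)
  have hPs : ContDiff ℝ ∞ (fun q : (Fin m → ℝ) × (Fin (l + n) → ℝ) => P q.2) :=
    hP.comp contDiff_snd
  have hg : ContDiff ℝ ∞ g :=
    (contDiff_fst.prodMk (contDiff_fst.comp hPs)).prodMk (contDiff_snd.comp hPs)
  have hgV : Set.MapsTo g (Metric.ball 0 δ ×ˢ S') (V ×ˢ S) := fun q hq =>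
    ⟨hδV (hprod δ hq.1 (hPS hq.2).1), (hPS hq.2).2.1⟩
  have hgs : Set.MapsTo g ((Metric.ball 0 δ \ singularSet UG G) ×ˢ S')
      ((V \ singularSet UF F) ×ˢ S) := fun q hq =>
    ⟨hreg _ _ hq.1 (hPS hq.2).1, (hPS hq.2).2.1⟩
  have hgτ : Continuous (fun q : ((Fin m → ℝ) × (Fin (l + n) → ℝ)) × (Fin d → unitInterval) =>
      (g q.1, q.2)) := (hg.continuous.comp continuous_fst).prodMk continuous_snd
  have hLflow : ∀ p ∈ Metric.ball 0 δ \ singularSet UF F, ∀ σ ∈ S ∩ Metric.ball σ₀ δ, ∀ τ,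
      FlowsTo (Metric.ball 0 R) F p (L p σ τ) (Ω p σ τ) := fun p hp σ hσ τ =>
    hδ₁L p ⟨Metric.ball_subset_ball hδδ₁ hp.1, hp.2⟩ σ
      ⟨hσ.1, Metric.ball_subset_ball hδδ₁ hσ.2⟩ τ
  have hdef : IsDeformation (Metric.ball 0 δ) S' k (endoSet UG G (Metric.ball 0 δ))
      (fun x s τ => (Ω (x, (P s).1) (P s).2 τ).1) := by
    refine ⟨?_, fun s hs τ => ?_, fun τ => ?_, fun i hi => ?_⟩
    · exact continuous_fst.comp_continuousOn
        (hΩ.continuousOn.comp hgτ.continuousOn fun q hq => ⟨hgV hq.1, trivial⟩)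
    · obtain ⟨hy, hσ⟩ := hPS hs
      refine fst_comp_slice_mem_endoSet (h := fun p => Ω p (P s).2 τ) (L := fun p => L p (P s).2 τ)
        hUG hG hUF hF hRG hFG hK hV hVU (hΩ.mem _ hσ.1 τ) ?_ hδR hδV
        (fun p hp => hLflow p hp _ hσ τ) hy
      have hc : Continuous (fun p : (Fin m → ℝ) × (Fin n → ℝ) => ((p, (P s).2), τ)) := by
        fun_prop
      exact hL.comp hc.continuousOn fun p hp => ⟨⟨hp, hσ.1⟩, trivial⟩
    · exact contDiff_fst.comp_contDiffOn ((hΩ.smooth τ).comp hg.contDiffOn hgV)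
    · exact continuousOn_iteratedFDerivWithin_comp_left_right
        (f := fun p τ => Ω p.1 p.2 τ) (hV.uniqueDiffOn.prod
          (uniqueDiffOn_of_eq_univ_or_halfSpace hS))
        (Metric.isOpen_ball.uniqueDiffOn.prod (uniqueDiffOn_of_eq_univ_or_halfSpace hS'))
        hΩ.smooth hg.contDiffOn hgV (ContinuousLinearMap.fst ℝ (Fin m → ℝ) (Fin n → ℝ)) i
        fun j hj => hΩ.jet j (le_trans (by exact_mod_cast hj) hi)
  have hP0 : P (Q (0, σ₀)) = (0, σ₀) := hPQ _ hO0
  have h0n : (0 : Fin n → ℝ) ∈ Metric.ball 0 δ := Metric.mem_ball_self hδ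
  -- The base parameter `Q (0, σ₀)` corresponds to `y = 0`, so the smooth shift function there is
  -- `α` restricted to the slice `y = 0`.
  obtain ⟨W, hW, hW0, hWext⟩ := hES (Metric.ball 0 δ) Metric.isOpen_ball
    ((convex_ball _ _).isConnected ⟨0, Metric.mem_ball_self hδ⟩) (Metric.mem_ball_self hδ) hδUG
    S' hS' _ hdef (Q (0, σ₀)) (hQS _ hO0 hσ₀) τ₀ (fun x => α (x, 0))
    (hα.comp (contDiff_id.prodMk contDiff_const).contDiffOn fun x hx => hδV (hprod δ hx h0n))
    (fun x hx => by
      simp only [hP0]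
      exact ((hδ₁α (x, 0) (Metric.ball_subset_ball hδδ₁ (hprod δ hx h0n))).fst hFG
        (hballfst R)).mono hRG)
    (fun x s τ => L (x, (P s).1) (P s).2 τ)
    (hL.comp hgτ.continuousOn fun q hq => ⟨hgs hq.1, trivial⟩)
    (fun x hx s hs τ => by
      obtain ⟨hy, hσ⟩ := hPS hs
      exact ((hLflow _ ⟨hprod δ hx.1 hy, (hreg _ _ hx hy).2⟩ _ hσ τ).fst hFG
        (hballfst R)).mono hRG)
    (fun x hx => by
      simp only [hP0]
      exact hLα _ (hreg _ _ hx h0n))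
  -- `ψ` is a local right inverse of `g`; pulling the extension for `G` back along it gives the
  -- extension for `F`.
  let ψ : ((Fin m → ℝ) × (Fin n → ℝ)) × (Fin l → ℝ) → (Fin m → ℝ) × (Fin (l + n) → ℝ) :=
    fun p => (p.1.1, Q (p.1.2, p.2))
  let D : Set (((Fin m → ℝ) × (Fin n → ℝ)) × (Fin l → ℝ)) :=
    (fun p => p.1) ⁻¹' Metric.ball 0 δ ∩ (fun p => (p.1.2, p.2)) ⁻¹' O
  have hD : IsOpen D := (Metric.isOpen_ball.preimage continuous_fst).inter
    (hO.preimage (by fun_prop))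
  have hψ : ContDiffOn ℝ ∞ ψ D := (contDiff_fst.comp contDiff_fst).contDiffOn.prodMk
    (hQ.comp ((contDiff_snd.comp contDiff_fst).prodMk contDiff_snd).contDiffOn fun p hp => hp.2)
  have hDW : IsOpen (D ∩ ψ ⁻¹' W) := hψ.continuousOn.isOpen_inter_preimage hD hW
  have hψmaps : Set.MapsTo ψ ((D ∩ ψ ⁻¹' W) ∩ V ×ˢ S) (W ∩ Metric.ball 0 δ ×ˢ S') :=
    fun p hp => ⟨hp.1.2, hballfst δ hp.1.1.1, hQS _ hp.1.1.2 hp.2.2⟩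
  refine ⟨D ∩ ψ ⁻¹' W, hDW, ⟨⟨Metric.mem_ball_self hδ, hO0⟩, hW0⟩, fun τ => ?_⟩
  obtain ⟨Lext, hLext, hLeq⟩ := hWext τ
  have hLψ : ContDiffOn ℝ ∞ (Lext ∘ ψ) ((D ∩ ψ ⁻¹' W) ∩ V ×ˢ S) :=
    hLext.comp (hψ.mono fun p hp => hp.1.1) hψmaps
  have hgen : ∀ p ∈ (D ∩ ψ ⁻¹' W) ∩ V ×ˢ S, p.1.1 ∉ singularSet UG G →
      (Lext ∘ ψ) p = L p.1 p.2 τ := by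
    intro p hp hps
    obtain ⟨hpW, hpδ, hpS⟩ := hψmaps hp
    have := hLeq (ψ p) ⟨hpW, ⟨hpδ, hps⟩, hpS⟩
    simp only [ψ, hPQ _ hp.1.1.2] at this
    exact this
  refine ⟨Lext ∘ ψ, hLψ, ?_⟩
  -- Possibly `G x = 0` here. With `y` and `σ` fixed, both functions are continuous at `x` and agree
  -- at nearby points off the zeros of `G`; such points accumulate at `x` because the zeros are
  -- nowhere dense in `N`.
  rintro ⟨⟨x, y⟩, σ⟩ ⟨hpW, hpV, hpS⟩
  have hι : Continuous (fun x' : Fin m → ℝ => ((x', y), σ)) := by fun_prop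
  have hev₁ : ∀ᶠ x' in 𝓝 x, ((x', y), σ) ∈ D ∩ ψ ⁻¹' W :=
    hι.continuousAt.eventually (hDW.mem_nhds hpW)
  have hev₂ : ∀ᶠ x' in 𝓝 x, (x', y) ∈ V \ singularSet UF F :=
    (by fun_prop : ContinuousAt (fun x' : Fin m → ℝ => (x', y)) x).eventually (hVs.mem_nhds hpV)
  have hlim₁ : ContinuousAt (fun x' => (Lext ∘ ψ) ((x', y), σ)) x := by
    refine ContinuousWithinAt.continuousAt
      (s := {x' | ((x', y), σ) ∈ D ∩ ψ ⁻¹' W ∧ (x', y) ∈ V \ singularSet UF F}) ?_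
      (hev₁.and hev₂)
    exact ContinuousWithinAt.comp (g := Lext ∘ ψ) (f := fun x' : Fin m → ℝ => ((x', y), σ))
      (hLψ.continuousOn _ ⟨hpW, hpV.1, hpS⟩) hι.continuousWithinAt
      fun x' hx' => ⟨hx'.1, hx'.2.1, hpS⟩
  have hlim₂ : ContinuousAt (fun x' => L (x', y) σ τ) x := by
    refine ContinuousWithinAt.continuousAt (s := {x' | (x', y) ∈ V \ singularSet UF F}) ?_ hev₂
    have hc : Continuous (fun x' : Fin m → ℝ => (((x', y), σ), τ)) := by fun_prop
    exact ContinuousWithinAt.comp (g := fun q : (((Fin m → ℝ) × (Fin n → ℝ)) × (Fin l → ℝ)) ×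
      (Fin d → unitInterval) => L q.1.1 q.1.2 q.2) (hL _ ⟨⟨hpV, hpS⟩, trivial⟩)
      hc.continuousWithinAt fun x' hx' => ⟨⟨hx', hpS⟩, trivial⟩
  have hxN : N ∈ 𝓝 x := Filter.mem_of_superset
    (Metric.isOpen_ball.mem_nhds (hballfst δ hpW.1.1))
    ((Metric.ball_subset_ball hδR').trans hR'N)
  have := hNd.neBot_nhdsWithin_compl hxN
  refine tendsto_nhds_unique_of_eventuallyEq (l := 𝓝[(singularSet UG G)ᶜ] x) (hlim₁.tendsto.mono_left nhdsWithin_le_nhds)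
    (hlim₂.tendsto.mono_left nhdsWithin_le_nhds) ?_
  filter_upwards [nhdsWithin_le_nhds hev₁, nhdsWithin_le_nhds hev₂, self_mem_nhdsWithin]
    with x' h₁ h₂ h₃
  exact hgen _ ⟨h₁, h₂.1, hpS⟩ h₃
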